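/- Let $k\ge 2$ be an integer and let $a=(a(n))_{n\ge 0}$ be a sequence generated by a finite deterministic automaton with output that reads the base-$k$ expansion of $n$, starting with the most significant digit (each state has exactly one outgoing edge for each of the digits $0,1,\dots,k-1$, and $a(n)$ is the output attached to the state reached from the initial state). Suppose that $a$ is synchronizing, that is, the automaton can be chosen so that there are a word $w\in\{0,1,\dots,k-1\}^*$ and a state $s$ such that reading $w$ leads to $s$ from every state. Then for every real number $c>1$ that is not an integer and every letter $\alpha$, the limits $$\lim_{N\to\infty}\frac1N\,\#\{0\le n<N : a(n)=\alpha\}\qquad\text{and}\qquad \lim_{N\to\infty}\frac1N\,\#\{0\le n<N : a(\lfloor n^c\rfloor)=\alpha\}$$ both exist and are equal. -/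

import Mathlib

/-- A deterministic automaton with output: state set `σ`, input alphabet `{0, …, k - 1}`,
exactly one outgoing edge per state and digit, an initial state, and an output letter in `A`
attached to every state. -/
structure DFAO (k : ℕ) (σ : Type*) (A : Type*) where
  step : σ → Fin k → σ
  start : σ
  output : σ → A

namespace DFAO

variable {k : ℕ} {σ A : Type*}

/-- The state reached from `q` after reading the word `w` from left to right. -/
def run (M : DFAO k σ A) (q : σ) (w : List (Fin k)) : σ :=
  w.foldl M.step q

/-- `w` is a synchronizing (reset) word: after reading `w` the automaton is in one specific
state `s`, no matter in which state it was started. -/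
def IsSynchronizingWord (M : DFAO k σ A) (w : List (Fin k)) : Prop :=
  ∃ s : σ, ∀ q : σ, M.run q w = s

end DFAO

/-- The base-`k` digital expansion of `n`, most significant digit first and without leading
zeros (the expansion of `0` is the empty word). -/
def digitExpansion (k : ℕ) (hk : 1 < k) (n : ℕ) : List (Fin k) :=
  ((Nat.digits k n).pmap (fun d hd => (⟨d, hd⟩ : Fin k))
    (fun _ hd => Nat.digits_lt_base hk hd)).reverse

/-- `M` generates the sequence `a`: on input the base-`k` expansion of `n`, most significant
digit first, `M` stops in a state with output `a n`. -/
def DFAO.Generates {k : ℕ} {σ A : Type*} (M : DFAO k σ A) (hk : 1 < k) (a : ℕ → A) : Prop :=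
  ∀ n : ℕ, M.output (M.run M.start (digitExpansion k hk n)) = a n

/-- `a` is a synchronizing `k`-automatic sequence: it is generated by a finite automaton that has
a synchronizing word. A reset word of one generating automaton also resets the minimal
automaton, which is a quotient of the reachable part. -/
def IsSynchronizingAutomaticBase {A : Type*} (k : ℕ) (hk : 1 < k) (a : ℕ → A) : Prop :=
  ∃ (σ : Type) (_ : Finite σ) (M : DFAO k σ A),
    M.Generates hk a ∧ ∃ w : List (Fin k), M.IsSynchronizingWord w

/-- `a` is a synchronizing automatic sequence (with respect to some base `k ≥ 2`). -/
def IsSynchronizingAutomatic {A : Type*} (a : ℕ → A) : Prop :=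
  ∃ (k : ℕ) (hk : 1 < k), IsSynchronizingAutomaticBase k hk a

/-- The letter `α` has asymptotic frequency `θ` in the sequence `b`:
`#{n < N : b n = α} / N → θ` as `N → ∞`. -/
def HasFrequency {A : Type*} (b : ℕ → A) (α : A) (θ : ℝ) : Prop :=
  Filter.Tendsto (fun N : ℕ => (Set.ncard {n : ℕ | n < N ∧ b n = α} : ℝ) / (N : ℝ))
    Filter.atTop (nhds θ)

/-! A word containing a synchronizing word is itself synchronizing. Hence, when `L` is large, for
all but a small proportion of the residues `r` modulo `k ^ L` the value `a n` is the same for all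
`n ≡ r` with `k ^ L ≤ n`, and the frequency of `α` along any sequence of indices which tends to
infinity and visits all residue classes modulo every `k ^ L` equally often is determined up to a
small error. It remains to see that `⌊n ^ c⌋` is such a sequence, that is, that `n ^ c` is
equidistributed on the circles `ℝ / k ^ L ℤ`. By Weyl's criterion this amounts to cancellation in
exponential sums with phase `γ n ^ c`: taking differences `⌊c⌋` times (van der Corput) leaves a
phase whose increments decrease to zero, but more slowly than `1 / n`, to which Fejér's theorem
applies. -/

open Filter Topology Finset MeasureTheory
open scoped InnerProductSpace

section CesaroMean

variable {E F : Type*} [NormedAddCommGroup E] [NormedSpace ℝ E] [NormedAddCommGroup F]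
  [NormedSpace ℝ F]

/-- The Cesàro mean `N⁻¹ ∑_{n < N} u n` of the first `N` terms of a sequence `u`. It is bundled as
a linear map in `u`, so that the `map_add` family of lemmas applies. -/
noncomputable def cesaroMean (N : ℕ) : (ℕ → E) →ₗ[ℝ] E :=
  (N : ℝ)⁻¹ • ∑ n ∈ range N, LinearMap.proj n

theorem cesaroMean_apply (u : ℕ → E) (N : ℕ) :
    cesaroMean N u = (N : ℝ)⁻¹ • ∑ n ∈ range N, u n := by
  simp [cesaroMean]

theorem cesaroMean_mono {u v : ℕ → ℝ} (h : u ≤ v) (N : ℕ) : cesaroMean N u ≤ cesaroMean N v := by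
  simp only [cesaroMean_apply, smul_eq_mul]
  gcongr with n
  exact h n

theorem norm_cesaroMean_le {u : ℕ → E} {v : ℕ → ℝ} (h : ∀ n, ‖u n‖ ≤ v n) (N : ℕ) :
    ‖cesaroMean N u‖ ≤ cesaroMean N v := by
  simp only [cesaroMean_apply, norm_smul, smul_eq_mul, norm_inv, Real.norm_natCast]
  gcongr
  exact norm_sum_le_of_le _ fun n _ => h n

theorem cesaroMean_const (e : E) {N : ℕ} (hN : N ≠ 0) : cesaroMean N (fun _ => e) = e := by
  rw [cesaroMean_apply, sum_const, card_range, ← Nat.cast_smul_eq_nsmul ℝ,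
    inv_smul_smul₀ (Nat.cast_ne_zero.2 hN)]

theorem norm_cesaroMean_le_of_forall_norm_le {u : ℕ → E} {C : ℝ} (h : ∀ n, ‖u n‖ ≤ C) (N : ℕ) :
    ‖cesaroMean N u‖ ≤ C := by
  rcases eq_or_ne N 0 with rfl | hN
  · simpa [cesaroMean_apply] using (norm_nonneg _).trans (h 0)
  · exact (norm_cesaroMean_le h N).trans_eq (cesaroMean_const C hN)

theorem norm_cesaroMean_sq_le (u : ℕ → E) (N : ℕ) :
    ‖cesaroMean N u‖ ^ 2 ≤ cesaroMean N fun n => ‖u n‖ ^ 2 := by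
  rcases eq_or_ne N 0 with rfl | hN
  · simp [cesaroMean_apply]
  have hsq : ‖∑ n ∈ range N, u n‖ ^ 2 ≤ N * ∑ n ∈ range N, ‖u n‖ ^ 2 :=
    calc ‖∑ n ∈ range N, u n‖ ^ 2 ≤ (∑ n ∈ range N, ‖u n‖) ^ 2 := by gcongr; exact norm_sum_le _ _
      _ ≤ N * ∑ n ∈ range N, ‖u n‖ ^ 2 := by
        simpa using sq_sum_le_card_mul_sum_sq (s := range N) (f := fun n => ‖u n‖)
  simp only [cesaroMean_apply, norm_smul, norm_inv, Real.norm_natCast, smul_eq_mul, mul_pow]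
  calc (N : ℝ)⁻¹ ^ 2 * ‖∑ n ∈ range N, u n‖ ^ 2
      ≤ (N : ℝ)⁻¹ ^ 2 * (N * ∑ n ∈ range N, ‖u n‖ ^ 2) := by gcongr
    _ = (N : ℝ)⁻¹ * ∑ n ∈ range N, ‖u n‖ ^ 2 := by field_simp

/-- The sequence `u` converges to `l` in the sense of Cesàro. -/
def HasCesaroMean (u : ℕ → E) (l : E) : Prop :=
  Tendsto (fun N => cesaroMean N u) atTop (𝓝 l)

theorem hasCesaroMean_of_tendsto {u : ℕ → E} {l : E} (h : Tendsto u atTop (𝓝 l)) :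
    HasCesaroMean u l :=
  h.cesaro_smul.congr fun N => (cesaroMean_apply u N).symm

theorem hasCesaroMean_const (e : E) : HasCesaroMean (fun _ => e) e :=
  hasCesaroMean_of_tendsto tendsto_const_nhds

namespace HasCesaroMean

variable {u v : ℕ → E} {l m : E}

protected theorem add (hu : HasCesaroMean u l) (hv : HasCesaroMean v m) :
    HasCesaroMean (fun n => u n + v n) (l + m) :=
  (Tendsto.add hu hv).congr fun N => (map_add (cesaroMean N) u v).symm

protected theorem sum {ι : Type*} {s : Finset ι} {u : ι → ℕ → E} {l : ι → E}
    (h : ∀ i ∈ s, HasCesaroMean (u i) (l i)) :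
    HasCesaroMean (fun n => ∑ i ∈ s, u i n) (∑ i ∈ s, l i) := by
  refine (tendsto_finsetSum s h).congr fun N => ?_
  rw [← map_sum]
  congr 1
  exact Finset.sum_fn s u

theorem map (h : HasCesaroMean u l) (f : E →L[ℝ] F) : HasCesaroMean (fun n => f (u n)) (f l) := by
  refine ((f.continuous.tendsto l).comp h).congr fun N => ?_
  simp [cesaroMean_apply]

theorem eventually_dist_cesaroMean_lt {e : ℕ → ℝ} {δ ε : ℝ} (hv : HasCesaroMean v m)
    (he : HasCesaroMean e δ) (hδ : δ < ε) (h : ∀ᶠ n in atTop, ‖u n - v n‖ ≤ e n) :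
    ∀ᶠ N in atTop, dist (cesaroMean N u) m < ε := by
  have hexcess : HasCesaroMean (fun n => max 0 (‖u n - v n‖ - e n)) 0 := by
    refine hasCesaroMean_of_tendsto (tendsto_const_nhds.congr' ?_)
    filter_upwards [h] with n hn
    rw [max_eq_left (sub_nonpos.2 hn)]
  have hbound := Tendsto.add (he.add hexcess) (tendsto_iff_dist_tendsto_zero.1 hv)
  simp only [add_zero] at hbound
  filter_upwards [hbound.eventually_lt_const hδ] with N hN
  refine ((dist_triangle _ (cesaroMean N v) _).trans ?_).trans_lt hN
  gcongr
  rw [dist_eq_norm, ← map_sub]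
  refine norm_cesaroMean_le (fun n => ?_) N
  have := le_max_right 0 (‖u n - v n‖ - e n)
  simp only [Pi.sub_apply]
  linarith

end HasCesaroMean

theorem hasCesaroMean_succ_sub {u : ℕ → E} {C : ℝ} (hu : ∀ n, ‖u n‖ ≤ C) :
    HasCesaroMean (fun n => u (n + 1) - u n) 0 := by
  have hlim : Tendsto (fun N : ℕ => (N : ℝ)⁻¹ * (C + C)) atTop (𝓝 0) := by
    simpa using (tendsto_inv_atTop_nhds_zero_nat (𝕜 := ℝ)).mul_const (C + C)
  refine squeeze_zero_norm (fun N => ?_) hlim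
  rw [cesaroMean_apply, sum_range_sub, norm_smul, norm_inv, Real.norm_natCast]
  gcongr
  exact norm_sub_le_of_le (hu N) (hu 0)

theorem hasCesaroMean_shift_sub {u : ℕ → E} {C : ℝ} (hu : ∀ n, ‖u n‖ ≤ C) (h : ℕ) :
    HasCesaroMean (fun n => u (n + h) - u n) 0 := by
  have htelescope : ∀ n, ∑ j ∈ range h, (u (n + j + 1) - u (n + j)) = u (n + h) - u n :=
    fun n => sum_range_sub (fun j => u (n + j)) h
  have hsum : HasCesaroMean (fun n => ∑ j ∈ range h, (u (n + j + 1) - u (n + j)))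
      (∑ _j ∈ range h, 0) := HasCesaroMean.sum fun j _ => by
    simpa only [add_right_comm _ 1 j] using hasCesaroMean_succ_sub (fun n => hu (n + j))
  simpa only [htelescope, sum_const_zero] using hsum

theorem hasCesaroMean_shift_iff {u : ℕ → E} {C : ℝ} (hu : ∀ n, ‖u n‖ ≤ C) (h : ℕ) {l : E} :
    HasCesaroMean (fun n => u (n + h)) l ↔ HasCesaroMean u l := by
  have hsub := hasCesaroMean_shift_sub hu h
  refine ⟨fun hl => ?_, fun hl => ?_⟩
  · simpa using hl.add (hsub.map (-ContinuousLinearMap.id ℝ E))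
  · simpa using hl.add hsub

end CesaroMean

section VanDerCorput

variable {E : Type*} [NormedAddCommGroup E] [InnerProductSpace ℝ E] {u : ℕ → E} {C : ℝ}

theorem hasCesaroMean_inner_shift_shift (hu : ∀ n, ‖u n‖ ≤ C)
    (h : ∀ d > 0, HasCesaroMean (fun n => ⟪u n, u (n + d)⟫_ℝ) 0) {i j : ℕ} (hij : i ≠ j) :
    HasCesaroMean (fun n => ⟪u (n + i), u (n + j)⟫_ℝ) 0 := by
  wlog hlt : i < j generalizing i j
  · simpa only [real_inner_comm] using this hij.symm (hij.lt_or_gt.resolve_left hlt)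
  obtain ⟨d, rfl⟩ := Nat.exists_eq_add_of_lt hlt
  have hbound : ∀ n, ‖⟪u n, u (n + (d + 1))⟫_ℝ‖ ≤ C * C := fun n =>
    (norm_inner_le_norm _ _).trans
      (mul_le_mul (hu _) (hu _) (norm_nonneg _) ((norm_nonneg _).trans (hu 0)))
  simpa only [add_assoc] using (hasCesaroMean_shift_iff hbound i).2 (h (d + 1) d.succ_pos)

theorem norm_sum_sq_le_card_mul_add_sum_inner {ι : Type*} [DecidableEq ι] (s : Finset ι)
    {v : ι → E} (hv : ∀ i ∈ s, ‖v i‖ ≤ C) :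
    ‖∑ i ∈ s, v i‖ ^ 2 ≤ #s * C ^ 2 + ∑ i ∈ s, ∑ j ∈ s.erase i, ⟪v i, v j⟫_ℝ := by
  rw [← real_inner_self_eq_norm_sq, sum_inner, ← nsmul_eq_mul, ← sum_const, ← sum_add_distrib]
  refine sum_le_sum fun i hi => ?_
  rw [inner_sum, ← add_sum_erase s _ hi, real_inner_self_eq_norm_sq]
  gcongr
  exact hv i hi

theorem eventually_norm_cesaroMean_window_sq_lt (hu : ∀ n, ‖u n‖ ≤ C)
    (h : ∀ d > 0, HasCesaroMean (fun n => ⟪u n, u (n + d)⟫_ℝ) 0) {H : ℕ} (hH : 0 < H) :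
    ∀ᶠ N in atTop, ‖cesaroMean N fun n => ∑ i ∈ range H, u (n + i)‖ ^ 2 < H * (C ^ 2 + 1) := by
  have hoff : HasCesaroMean (fun n => H * C ^ 2 +
      ∑ i ∈ range H, ∑ j ∈ (range H).erase i, ⟪u (n + i), u (n + j)⟫_ℝ) (H * C ^ 2) := by
    simpa using (hasCesaroMean_const (H * C ^ 2)).add
      (HasCesaroMean.sum fun i _ => HasCesaroMean.sum fun j hj =>
        hasCesaroMean_inner_shift_shift hu h (ne_of_mem_erase hj).symm)
  have hlt : H * C ^ 2 < H * (C ^ 2 + 1) := by gcongr; exact lt_add_one _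
  filter_upwards [hoff.eventually_lt_const hlt] with N hN
  refine ((norm_cesaroMean_sq_le _ N).trans (cesaroMean_mono (fun n => ?_) N)).trans_lt hN
  simpa using norm_sum_sq_le_card_mul_add_sum_inner (range H) (fun i _ => hu (n + i))

/-- Van der Corput's difference theorem. Averaging `u` over windows of length `H` does not change
its Cesàro means asymptotically, but as distinct shifts of `u` are orthogonal on average, the
mean square of these window averages is of order `1 / H`. -/
theorem hasCesaroMean_zero_of_inner_shift (hu : ∀ n, ‖u n‖ ≤ C)
    (h : ∀ d > 0, HasCesaroMean (fun n => ⟪u n, u (n + d)⟫_ℝ) 0) : HasCesaroMean u 0 := by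
  refine Metric.tendsto_nhds.2 fun ε hε => ?_
  obtain ⟨H, hH⟩ := exists_nat_gt ((C ^ 2 + 1) / (ε / 2) ^ 2)
  have hH0 : (0 : ℝ) < H := lt_of_le_of_lt (by positivity) hH
  have hdiff : HasCesaroMean (fun n => ∑ i ∈ range H, (u (n + i) - u n)) 0 := by
    simpa using HasCesaroMean.sum fun i (_ : i ∈ range H) => hasCesaroMean_shift_sub hu i
  filter_upwards [eventually_norm_cesaroMean_window_sq_lt hu h (Nat.cast_pos.1 hH0),
    hdiff.norm.eventually_lt_const (u := H * (ε / 2)) (by rw [norm_zero]; positivity)]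
    with N hwindow hshift
  set window : ℕ → E := fun n => ∑ i ∈ range H, u (n + i)
  have hwindow' : ‖cesaroMean N window‖ < H * (ε / 2) := by
    refine lt_of_pow_lt_pow_left₀ 2 (by positivity) (hwindow.trans ?_)
    rw [div_lt_iff₀ (by positivity)] at hH
    nlinarith
  have hsplit : (H : ℝ) • cesaroMean N u =
      cesaroMean N window - cesaroMean N fun n => ∑ i ∈ range H, (u (n + i) - u n) := by
    rw [← map_sub, ← map_smul]
    congr 1
    ext n
    simp [window, Nat.cast_smul_eq_nsmul]
  have hnorm : H * ‖cesaroMean N u‖ < H * ε := by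
    rw [← Real.norm_natCast H, ← norm_smul, hsplit, Real.norm_natCast]
    linarith [norm_sub_le (cesaroMean N window)
      (cesaroMean N fun n => ∑ i ∈ range H, (u (n + i) - u n))]
  simpa using lt_of_mul_lt_mul_left hnorm hH0.le

end VanDerCorput

section Fejer

variable {E : Type*} [NormedAddCommGroup E] [NormedSpace ℝ E]

theorem norm_sum_smul_sub_sub_smul_le {u : ℕ → E} {C : ℝ} (hu : ∀ n, ‖u n‖ ≤ C) {g : ℕ → ℝ}
    (hg : Monotone g) (hg0 : 0 ≤ g 0) (N : ℕ) :
    ‖∑ n ∈ range N, g n • (u (n + 1) - u n) - g N • u N‖ ≤ C * g N := by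
  induction N with
  | zero =>
    rw [range_zero, sum_empty, zero_sub, norm_neg, norm_smul, Real.norm_of_nonneg hg0, mul_comm]
    gcongr
    exact hu 0
  | succ N ih =>
    have hinc : 0 ≤ g (N + 1) - g N := sub_nonneg.2 (hg N.le_succ)
    calc ‖∑ n ∈ range (N + 1), g n • (u (n + 1) - u n) - g (N + 1) • u (N + 1)‖
        = ‖(∑ n ∈ range N, g n • (u (n + 1) - u n) - g N • u N)
            - (g (N + 1) - g N) • u (N + 1)‖ := by
          rw [sum_range_succ]
          congr 1
          module
      _ ≤ C * g N + (g (N + 1) - g N) * C := by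
          refine norm_sub_le_of_le ih ?_
          rw [norm_smul, Real.norm_of_nonneg hinc]
          gcongr
          exact hu _
      _ = C * g (N + 1) := by ring

theorem norm_sum_smul_sub_le {u : ℕ → E} {C : ℝ} (hu : ∀ n, ‖u n‖ ≤ C) {g : ℕ → ℝ}
    (hg : Monotone g) (hg0 : 0 ≤ g 0) (N : ℕ) :
    ‖∑ n ∈ range N, g n • (u (n + 1) - u n)‖ ≤ 2 * C * g N := by
  have hgN : 0 ≤ g N := hg0.trans (hg N.zero_le)
  have hlast : ‖g N • u N‖ ≤ g N * C := by
    rw [norm_smul, Real.norm_of_nonneg hgN]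
    gcongr
    exact hu N
  linarith [norm_sub_norm_le (∑ n ∈ range N, g n • (u (n + 1) - u n)) (g N • u N),
    norm_sum_smul_sub_sub_smul_le hu hg hg0 N]

theorem norm_exp_add_I_mul_inv_smul_sub_le (y : ℝ) {d : ℝ} (hd : 0 < d) (hd1 : d ≤ 1) :
    ‖Complex.exp (y * Complex.I) + Complex.I *
        d⁻¹ • (Complex.exp ((y + d : ℝ) * Complex.I) - Complex.exp (y * Complex.I))‖ ≤ d := by
  have hnorm : ‖(d : ℂ) * Complex.I‖ = d := by
    rw [norm_mul, Complex.norm_I, mul_one, Complex.norm_of_nonneg hd.le]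
  have htaylor := Complex.norm_exp_sub_one_sub_id_le (hnorm.trans_le hd1)
  rw [hnorm] at htaylor
  have hfactor : Complex.exp (y * Complex.I) + Complex.I *
        d⁻¹ • (Complex.exp ((y + d : ℝ) * Complex.I) - Complex.exp (y * Complex.I)) =
      Complex.I * Complex.exp (y * Complex.I) *
        d⁻¹ • (Complex.exp (d * Complex.I) - 1 - d * Complex.I) := by
    have hd0 : (d : ℂ) ≠ 0 := Complex.ofReal_ne_zero.2 hd.ne'
    simp only [Complex.ofReal_add, add_mul, Complex.exp_add, Complex.real_smul, Complex.ofReal_inv]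
    field_simp
    linear_combination (d : ℂ) * Complex.I_sq
  calc _ = d⁻¹ * ‖Complex.exp (d * Complex.I) - 1 - d * Complex.I‖ := by
        rw [hfactor, norm_mul, norm_mul, Complex.norm_I, Complex.norm_exp_ofReal_mul_I, norm_smul,
          norm_inv, Real.norm_of_nonneg hd.le, one_mul, one_mul]
    _ ≤ d⁻¹ * d ^ 2 := by gcongr
    _ = d := by field_simp

/-- Fejér's theorem. Up to an error of size `d n = y (n + 1) - y n`, the number `exp (i y n)` is
`-i / d n` times the increment of `exp (i y n)`, and the sum of the latter is estimated by parts. -/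
theorem hasCesaroMean_exp_of_antitone_sub {y : ℕ → ℝ}
    (hanti : Antitone fun n => y (n + 1) - y n)
    (hzero : Tendsto (fun n => y (n + 1) - y n) atTop (𝓝 0))
    (htop : Tendsto (fun n : ℕ => n * (y (n + 1) - y n)) atTop atTop) :
    HasCesaroMean (fun n => Complex.exp (y n * Complex.I)) 0 := by
  set d : ℕ → ℝ := fun n => y (n + 1) - y n with hd
  set u : ℕ → ℂ := fun n => Complex.exp (y n * Complex.I)
  have hpos (n : ℕ) : 0 < d n := by
    obtain ⟨m, hm, hnm⟩ := ((htop.eventually_gt_atTop 0).and (eventually_ge_atTop n)).exists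
    exact (pos_of_mul_pos_right hm m.cast_nonneg).trans_le (hanti hnm)
  have hu1 (n : ℕ) : ‖u n‖ ≤ 1 := (Complex.norm_exp_ofReal_mul_I _).le
  have herror : Tendsto (fun n => u n + Complex.I * (d n)⁻¹ • (u (n + 1) - u n)) atTop (𝓝 0) := by
    refine squeeze_zero_norm' ?_ hzero
    filter_upwards [hzero.eventually_le_const one_pos] with n hn
    simpa only [hd, add_sub_cancel] using norm_exp_add_I_mul_inv_smul_sub_le (y n) (hpos n) hn
  have hparts : HasCesaroMean (fun n => (d n)⁻¹ • (u (n + 1) - u n)) 0 := by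
    have hlim : Tendsto (fun N : ℕ => 2 * ((N : ℝ) * d N)⁻¹) atTop (𝓝 0) := by
      simpa using (tendsto_inv_atTop_zero.comp htop).const_mul 2
    refine squeeze_zero_norm (fun N => ?_) hlim
    rw [cesaroMean_apply, norm_smul, norm_inv, Real.norm_natCast, mul_inv, mul_left_comm]
    gcongr
    simpa using norm_sum_smul_sub_le hu1 (g := fun n => (d n)⁻¹)
      (fun i j hij => inv_anti₀ (hpos j) (hanti hij)) (inv_pos.2 (hpos 0)).le N
  simpa using (hasCesaroMean_of_tendsto herror).add
    (hparts.map (-ContinuousLinearMap.mul ℝ ℂ Complex.I))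

end Fejer

section SlowlyDecaying

/-- The function `g` decreases to zero on the positive half-line, more slowly than `1 / x`. This is
the condition on the derivative of a phase `f` under which the numbers `exp (i f n)` cancel. -/
structure SlowlyDecaying (g : ℝ → ℝ) : Prop where
  antitoneOn : AntitoneOn g (Set.Ioi 0)
  tendsto_zero : Tendsto g atTop (𝓝 0)
  tendsto_mul_atTop : Tendsto (fun x => x * g x) atTop atTop

theorem slowlyDecaying_const_mul_rpow {K s : ℝ} (hK : 0 < K) (hs : -1 < s) (hs0 : s < 0) :
    SlowlyDecaying fun x => K * x ^ s where
  antitoneOn _ hx _ _ hxy :=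
    mul_le_mul_of_nonneg_left (Real.rpow_le_rpow_of_nonpos hx hxy hs0.le) hK.le
  tendsto_zero := by
    simpa using (tendsto_rpow_neg_atTop (neg_pos.2 hs0)).const_mul K
  tendsto_mul_atTop := by
    refine ((tendsto_rpow_atTop (neg_lt_iff_pos_add.1 hs)).const_mul_atTop hK).congr' ?_
    filter_upwards [eventually_gt_atTop 0] with x hx
    rw [Real.rpow_add_one hx.ne']
    ring

theorem exists_mem_Ioo_sub_eq_mul {f g : ℝ → ℝ} (hf : ∀ x > 0, HasDerivAt f (g x) x) {h x : ℝ}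
    (hh : 0 < h) (hx : 0 < x) : ∃ ξ ∈ Set.Ioo x (x + h), f (x + h) - f x = h * g ξ := by
  obtain ⟨ξ, hξ, hslope⟩ := exists_hasDerivAt_eq_slope f g (lt_add_of_pos_right x hh)
    (fun z hz => (hf z (hx.trans_le hz.1)).continuousAt.continuousWithinAt)
    (fun z hz => hf z (hx.trans hz.1))
  refine ⟨ξ, hξ, ?_⟩
  rw [hslope, add_sub_cancel_left, mul_div_cancel₀ _ hh.ne']

theorem SlowlyDecaying.sub_of_hasDerivAt {f g : ℝ → ℝ} (hg : SlowlyDecaying g)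
    (hf : ∀ x > 0, HasDerivAt f (g x) x) {h : ℝ} (hh : 0 < h) :
    SlowlyDecaying fun x => f (x + h) - f x := by
  have hderiv (x : ℝ) (hx : 0 < x) :
      HasDerivAt (fun x => f (x + h) - f x) (g (x + h) - g x) x :=
    ((hf (x + h) (by positivity)).comp_add_const x h).sub (hf x hx)
  have hupper (x : ℝ) (hx : 0 < x) : f (x + h) - f x ≤ h * g x := by
    obtain ⟨ξ, ⟨hxξ, -⟩, hξ⟩ := exists_mem_Ioo_sub_eq_mul hf hh hx
    rw [hξ]
    gcongr
    exact hg.antitoneOn hx (hx.trans hxξ) hxξ.le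
  have hlower (x : ℝ) (hx : 0 < x) : h * g (x + h) ≤ f (x + h) - f x := by
    obtain ⟨ξ, ⟨hxξ, hξx⟩, hξ⟩ := exists_mem_Ioo_sub_eq_mul hf hh hx
    rw [hξ]
    gcongr
    exact hg.antitoneOn (hx.trans hxξ) (Set.mem_Ioi.2 (by positivity)) hξx.le
  have hshift : Tendsto (fun x : ℝ => x + h) atTop atTop :=
    tendsto_atTop_add_const_right _ _ tendsto_id
  have hzero : Tendsto (fun x => h * g (x + h)) atTop (𝓝 0) := by
    simpa using (hg.tendsto_zero.comp hshift).const_mul h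
  refine ⟨?_, ?_, ?_⟩
  · refine antitoneOn_of_hasDerivWithinAt_nonpos (convex_Ioi 0)
      (fun x hx => (hderiv x hx).continuousAt.continuousWithinAt)
      (fun x hx => (hderiv x (interior_subset hx)).hasDerivWithinAt) fun x hx => ?_
    have hx0 : 0 < x := interior_subset hx
    exact sub_nonpos.2 (hg.antitoneOn hx0 (Set.mem_Ioi.2 (by positivity)) (by linarith))
  · refine tendsto_of_tendsto_of_tendsto_of_le_of_le' hzero
      (by simpa using hg.tendsto_zero.const_mul h) ?_ ?_
    · filter_upwards [eventually_gt_atTop 0] with x hx using hlower x hx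
    · filter_upwards [eventually_gt_atTop 0] with x hx using hupper x hx
  · have hmul : Tendsto (fun x => h * ((x + h) * g (x + h)) + -(h * (h * g (x + h)))) atTop atTop :=
      ((hg.tendsto_mul_atTop.comp hshift).const_mul_atTop hh).atTop_add (hzero.const_mul h).neg
    refine tendsto_atTop_mono' _ ?_ hmul
    filter_upwards [eventually_gt_atTop 0] with x hx
    calc h * ((x + h) * g (x + h)) + -(h * (h * g (x + h))) = x * (h * g (x + h)) := by ring
      _ ≤ x * (f (x + h) - f x) := by gcongr; exact hlower x hx

theorem SlowlyDecaying.hasCesaroMean_exp {f : ℝ → ℝ}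
    (h : SlowlyDecaying fun x => f (x + 1) - f x) :
    HasCesaroMean (fun n : ℕ => Complex.exp (f (n + 1) * Complex.I)) 0 := by
  have hshift : Tendsto (fun n : ℕ => (n : ℝ) + 1) atTop atTop :=
    tendsto_atTop_add_const_right _ _ tendsto_natCast_atTop_atTop
  refine hasCesaroMean_exp_of_antitone_sub (y := fun n => f (n + 1)) ?_ ?_ ?_
  · intro m n hmn
    simpa using h.antitoneOn (Set.mem_Ioi.2 (by positivity)) (Set.mem_Ioi.2 (by positivity))
      (show (m : ℝ) + 1 ≤ n + 1 by gcongr)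
  · simpa [Function.comp_def] using h.tendsto_zero.comp hshift
  · refine ((h.tendsto_mul_atTop.comp hshift).atTop_add
      (h.tendsto_zero.comp hshift).neg).congr fun n => ?_
    simp only [Function.comp_apply, Nat.cast_add, Nat.cast_one]
    ring

theorem real_inner_exp_ofReal_mul_I (x y : ℝ) :
    ⟪Complex.exp (x * Complex.I), Complex.exp (y * Complex.I)⟫_ℝ =
      (Complex.exp ((y - x : ℝ) * Complex.I)).re := by
  rw [Complex.inner, ← Complex.exp_conj, ← Complex.exp_add]
  congr 2
  simp
  ring

/-- Van der Corput's theorem reduces the order of the slowly decaying derivative by one, since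
taking correlations replaces the phase `F 0` by `fun x => F 0 (x + d) - F 0 x`. -/
theorem hasCesaroMean_exp_of_slowlyDecaying_deriv {k : ℕ} {F : ℕ → ℝ → ℝ}
    (hF : ∀ i, ∀ x > 0, HasDerivAt (F i) (F (i + 1) x) x) (h : SlowlyDecaying (F (k + 1))) :
    HasCesaroMean (fun n : ℕ => Complex.exp (F 0 (n + 1) * Complex.I)) 0 := by
  induction k generalizing F with
  | zero => exact (h.sub_of_hasDerivAt (hF 0) one_pos).hasCesaroMean_exp
  | succ k ih =>
    refine hasCesaroMean_zero_of_inner_shift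
      (fun n => (Complex.norm_exp_ofReal_mul_I _).le) fun d hd => ?_
    have hd0 : (0 : ℝ) < d := Nat.cast_pos.2 hd
    have hdiff := (ih (F := fun i x => F i (x + d) - F i x)
      (fun i x hx => ((hF i (x + d) (by positivity)).comp_add_const x d).sub (hF i x hx))
      (h.sub_of_hasDerivAt (hF (k + 1)) hd0)).map Complex.reCLM
    simpa only [real_inner_exp_ofReal_mul_I, Nat.cast_add, add_right_comm _ (d : ℝ) 1, map_zero,
      Complex.reCLM_apply] using hdiff

theorem hasDerivAt_prod_sub_mul_rpow (γ c : ℝ) (i : ℕ) {x : ℝ} (hx : 0 < x) :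
    HasDerivAt (fun x => (γ * ∏ j ∈ range i, (c - j)) * x ^ (c - i))
      ((γ * ∏ j ∈ range (i + 1), (c - j)) * x ^ (c - (i + 1 : ℕ))) x := by
  refine ((Real.hasDerivAt_rpow_const (Or.inl hx.ne')).const_mul _).congr_deriv ?_
  rw [prod_range_succ, Nat.cast_succ, ← sub_sub]
  ring

theorem hasCesaroMean_exp_mul_rpow {γ c : ℝ} (hγ : 0 < γ) (hc : 0 < c) (hcz : ∀ m : ℤ, c ≠ m) :
    HasCesaroMean (fun n : ℕ => Complex.exp ((γ * (n : ℝ) ^ c : ℝ) * Complex.I)) 0 := by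
  set k := ⌊c⌋₊
  have hk : (k : ℝ) < c :=
    lt_of_le_of_ne (Nat.floor_le hc.le) fun h => hcz k (by exact_mod_cast h.symm)
  have hk1 : c < k + 1 := Nat.lt_floor_add_one c
  have hcoeff : 0 < γ * ∏ j ∈ range (k + 1), (c - j) := by
    refine mul_pos hγ (prod_pos fun j hj => sub_pos.2 (lt_of_le_of_lt ?_ hk))
    exact_mod_cast mem_range_succ_iff.1 hj
  rw [← hasCesaroMean_shift_iff (fun n => (Complex.norm_exp_ofReal_mul_I _).le) 1]
  simpa using hasCesaroMean_exp_of_slowlyDecaying_deriv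
    (F := fun i x => (γ * ∏ j ∈ range i, (c - j)) * x ^ (c - i))
    (fun i x hx => hasDerivAt_prod_sub_mul_rpow γ c i hx)
    (slowlyDecaying_const_mul_rpow hcoeff (by push_cast; linarith) (by push_cast; linarith))

end SlowlyDecaying

section Equidistribution

/-- The sequence `x` is equidistributed in the compact space `X` with respect to the probability
measure `μ`: averages of continuous functions along `x` converge to their integrals. -/
def IsEquidistributed {X : Type*} [TopologicalSpace X] [MeasurableSpace X] (μ : Measure X)
    (x : ℕ → X) : Prop :=
  ∀ f : C(X, ℝ), HasCesaroMean (fun n => f (x n)) (∫ t, f t ∂μ)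

theorem IsEquidistributed.eventually_cesaroMean_indicator_lt {X : Type*} [TopologicalSpace X]
    [NormalSpace X] [MeasurableSpace X] [OpensMeasurableSpace X] {μ : Measure X}
    [IsFiniteMeasure μ] [μ.OuterRegular] {x : ℕ → X} (hx : IsEquidistributed μ x) {K : Set X}
    (hK : IsClosed K) {r : ℝ} (hr : μ.real K < r) :
    ∀ᶠ N in atTop, cesaroMean N ({n | x n ∈ K}.indicator 1) < r := by
  obtain ⟨U, hKU, hU, hUr⟩ := K.exists_isOpen_lt_of_lt _
    ((ENNReal.lt_ofReal_iff_toReal_lt (measure_ne_top μ K)).2 hr)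
  obtain ⟨f, hf0, hf1, hf⟩ := exists_continuous_zero_one_of_isClosed hU.isClosed_compl hK
    (Set.disjoint_compl_left_iff_subset.2 hKU)
  have hint : ∫ t, f t ∂μ < r := by
    calc ∫ t, f t ∂μ ≤ ∫ t, U.indicator 1 t ∂μ := by
          refine integral_mono_of_nonneg (.of_forall fun t => (hf t).1)
            ((integrable_const 1).indicator hU.measurableSet) (.of_forall fun t => ?_)
          by_cases ht : t ∈ U
          · simpa [ht] using (hf t).2
          · simpa [ht] using (hf0 ht).le
      _ = μ.real U := integral_indicator_one hU.measurableSet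
      _ < r := (ENNReal.lt_ofReal_iff_toReal_lt (measure_ne_top μ U)).1 hUr
  filter_upwards [(hx f).eventually_lt_const hint] with N hN
  refine (cesaroMean_mono (fun n => ?_) N).trans_lt hN
  by_cases hn : x n ∈ K
  · simpa [hn] using (hf1 hn).ge
  · simpa [hn] using (hf (x n)).1

section CompactSpace

variable {X : Type*} [TopologicalSpace X] [CompactSpace X] [MeasurableSpace X]
  [OpensMeasurableSpace X] (μ : Measure X) [IsProbabilityMeasure μ]

theorem integrable_continuousMap (f : C(X, ℂ)) : Integrable f μ :=
  (BoundedContinuousFunction.mkOfCompact f).integrable μ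

theorem isClosed_setOf_hasCesaroMean_integral (x : ℕ → X) :
    IsClosed {f : C(X, ℂ) | HasCesaroMean (fun n => f (x n)) (∫ t, f t ∂μ)} := by
  have hlip (N : ℕ) : LipschitzWith 1 fun f : C(X, ℂ) => cesaroMean N fun n => f (x n) :=
    LipschitzWith.of_dist_le_mul fun f g => by
      rw [NNReal.coe_one, one_mul, dist_eq_norm, dist_eq_norm, ← map_sub]
      exact norm_cesaroMean_le_of_forall_norm_le (fun n => (f - g).norm_coe_le_norm (x n)) N
  have hint : LipschitzWith 1 fun f : C(X, ℂ) => ∫ t, f t ∂μ :=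
    LipschitzWith.of_dist_le_mul fun f g => by
      rw [NNReal.coe_one, one_mul, dist_eq_norm, dist_eq_norm,
        ← integral_sub (integrable_continuousMap μ f) (integrable_continuousMap μ g)]
      simpa using norm_integral_le_of_norm_le_const (μ := μ)
        (.of_forall fun t => (f - g).norm_coe_le_norm t)
  exact (LipschitzWith.uniformEquicontinuous _ 1 hlip).equicontinuous.isClosed_setOfPred_tendsto
    hint.continuous

theorem hasCesaroMean_integral_of_topologicalClosure_span_eq_top {S : Set C(X, ℂ)}
    (hS : (Submodule.span ℂ S).topologicalClosure = ⊤) {x : ℕ → X}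
    (h : ∀ f ∈ S, HasCesaroMean (fun n => f (x n)) (∫ t, f t ∂μ)) (f : C(X, ℂ)) :
    HasCesaroMean (fun n => f (x n)) (∫ t, f t ∂μ) := by
  have hspan : ∀ f ∈ Submodule.span ℂ S, HasCesaroMean (fun n => f (x n)) (∫ t, f t ∂μ) := by
    intro f hf
    induction hf using Submodule.span_induction with
    | mem f hf => exact h f hf
    | zero => simpa using hasCesaroMean_const (0 : ℂ)
    | add f g _ _ hf hg =>
      simpa [integral_add (integrable_continuousMap μ f) (integrable_continuousMap μ g)]
        using hf.add hg
    | smul z f _ hf =>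
      simpa [integral_const_mul] using hf.map (ContinuousLinearMap.mul ℝ ℂ z)
  refine closure_minimal hspan (isClosed_setOf_hasCesaroMean_integral μ x) ?_
  rw [← Submodule.topologicalClosure_coe, hS]
  trivial

end CompactSpace

variable {T : ℝ} [hT : Fact (0 < T)]

theorem integral_fourier_haarAddCircle {h : ℤ} (hh : h ≠ 0) :
    ∫ t : AddCircle T, fourier h t ∂AddCircle.haarAddCircle = 0 :=
  integral_eq_zero_of_add_right_eq_neg (fourier_add_half_inv_index hh hT.out)

/-- Weyl's criterion. Complex conjugation exchanges the frequencies `h` and `-h`, so it is enough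
to test one sign. -/
theorem isEquidistributed_haarAddCircle_of_fourier {x : ℕ → AddCircle T}
    (hx : ∀ h : ℤ, 0 < h → HasCesaroMean (fun n => fourier h (x n)) 0) :
    IsEquidistributed AddCircle.haarAddCircle x := by
  have hfourier (h : ℤ) : HasCesaroMean (fun n => fourier h (x n))
      (∫ t : AddCircle T, fourier h t ∂AddCircle.haarAddCircle) := by
    rcases lt_trichotomy h 0 with hneg | rfl | hpos
    · rw [integral_fourier_haarAddCircle hneg.ne]
      simpa [← fourier_neg] using
        (hx (-h) (neg_pos.2 hneg)).map (Complex.conjCLE : ℂ →L[ℝ] ℂ)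
    · simpa using hasCesaroMean_const (1 : ℂ)
    · rw [integral_fourier_haarAddCircle hpos.ne']
      exact hx h hpos
  intro f
  have hcomplex := hasCesaroMean_integral_of_topologicalClosure_span_eq_top
    AddCircle.haarAddCircle (span_fourier_closure_eq_top (T := T))
    (Set.forall_mem_range.2 hfourier)
    ⟨fun t => (f t : ℂ), by fun_prop⟩
  simpa [integral_complex_ofReal] using hcomplex.map Complex.reCLM

theorem isEquidistributed_mul_rpow_addCircle {c : ℝ} (hc : 0 < c) (hcz : ∀ m : ℤ, c ≠ m) :
    IsEquidistributed AddCircle.haarAddCircle fun n : ℕ => (((n : ℝ) ^ c : ℝ) : AddCircle T) := by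
  refine isEquidistributed_haarAddCircle_of_fourier fun h hh => ?_
  have hγ : 0 < 2 * Real.pi * h / T := by have := hT.out; positivity
  convert hasCesaroMean_exp_mul_rpow hγ hc hcz using 2 with n
  rw [fourier_coe_apply]
  congr 1
  push_cast
  ring

end Equidistribution

section Residues

theorem tendsto_of_sum_eq_of_forall_eventually_lt {ι β : Type*} {s : Finset ι} {l : Filter β}
    {u : ι → β → ℝ} {θ : ι → ℝ} (hsum : ∀ᶠ N in l, ∑ i ∈ s, u i N = ∑ i ∈ s, θ i)
    (h : ∀ i ∈ s, ∀ r > θ i, ∀ᶠ N in l, u i N < r) {i : ι} (hi : i ∈ s) :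
    Tendsto (u i) l (𝓝 (θ i)) := by
  classical
  refine tendsto_order.2 ⟨fun a ha => ?_, h i hi⟩
  have hcard : (0 : ℝ) < #s := Nat.cast_pos.2 (card_pos.2 ⟨i, hi⟩)
  set δ : ℝ := (θ i - a) / #s
  have hδ : 0 < δ := div_pos (sub_pos.2 ha) hcard
  have hδ_mul : #s * δ = θ i - a := mul_div_cancel₀ _ hcard.ne'
  filter_upwards [hsum, (eventually_all_finset s).2 fun j hj => h j hj _ (lt_add_of_pos_right _ hδ)]
    with N htotal hupper
  have hrest : ∑ j ∈ s.erase i, u j N ≤ ∑ j ∈ s.erase i, θ j + #(s.erase i) * δ := by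
    rw [← nsmul_eq_mul, ← sum_const, ← sum_add_distrib]
    exact sum_le_sum fun j hj => (hupper j (mem_of_mem_erase hj)).le
  have hlt : #(s.erase i) * δ < #s * δ := by
    gcongr
    exact erase_ssubset hi
  rw [← add_sum_erase s _ hi, ← add_sum_erase s _ hi] at htotal
  linarith

theorem hasFrequency_iff_hasCesaroMean {A : Type*} (b : ℕ → A) (α : A) (θ : ℝ) :
    HasFrequency b α θ ↔ HasCesaroMean ({n | b n = α}.indicator 1) θ := by
  classical
  refine tendsto_congr fun N => ?_
  have hcard : {n : ℕ | n < N ∧ b n = α} = ({n ∈ range N | b n = α} : Finset ℕ) := by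
    ext n
    simp
  rw [hcard, Set.ncard_coe_finset, cesaroMean_apply, smul_eq_mul, div_eq_inv_mul]
  simp [Set.indicator_apply]

/-- The sequence `b` visits all residue classes modulo `m` with the same frequency. -/
def EquidistributedMod (m : ℕ) (b : ℕ → ℕ) : Prop :=
  ∀ r < m, HasFrequency (fun n => b n % m) r (1 / m)

theorem sum_indicator_mod_eq (b : ℕ → ℕ) (m : ℕ) (S : Finset ℕ) :
    ∑ r ∈ S, {n | b n % m = r}.indicator (1 : ℕ → ℝ) = {n | b n % m ∈ S}.indicator 1 := by
  ext n
  simp [Set.indicator_apply]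

theorem EquidistributedMod.hasCesaroMean_indicator {m : ℕ} {b : ℕ → ℕ}
    (hb : EquidistributedMod m b) {S : Finset ℕ} (hS : S ⊆ range m) :
    HasCesaroMean ({n | b n % m ∈ S}.indicator (1 : ℕ → ℝ)) (#S / m) := by
  have hsum := HasCesaroMean.sum fun r hr =>
    (hasFrequency_iff_hasCesaroMean _ _ _).1 (hb r (mem_range.1 (hS hr)))
  rw [sum_const, nsmul_eq_mul, mul_one_div, ← Finset.sum_fn, sum_indicator_mod_eq] at hsum
  exact hsum

theorem equidistributedMod_of_eventually_lt {m : ℕ} {b : ℕ → ℕ}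
    (h : ∀ r < m, ∀ θ > 1 / (m : ℝ),
      ∀ᶠ N in atTop, cesaroMean N ({n | b n % m = r}.indicator 1) < θ) :
    EquidistributedMod m b := by
  intro r hr
  have hm : 0 < m := r.zero_le.trans_lt hr
  refine (hasFrequency_iff_hasCesaroMean _ _ _).2 <|
    tendsto_of_sum_eq_of_forall_eventually_lt (s := range m) (θ := fun _ => 1 / (m : ℝ))
      (u := fun r N => cesaroMean N ({n | b n % m = r}.indicator 1)) ?_
      (fun r hr => h r (mem_range.1 hr)) (mem_range.2 hr)
  filter_upwards [eventually_ne_atTop 0] with N hN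
  have hall : {n | b n % m ∈ range m} = Set.univ :=
    Set.eq_univ_of_forall fun n => mem_range.2 (Nat.mod_lt _ hm)
  rw [← map_sum, sum_indicator_mod_eq, hall, Set.indicator_univ, sum_const, card_range,
    nsmul_eq_mul, mul_one_div_cancel (Nat.cast_ne_zero.2 hm.ne')]
  exact cesaroMean_const (1 : ℝ) hN

theorem equidistributedMod_id (m : ℕ) : EquidistributedMod m id := by
  refine equidistributedMod_of_eventually_lt fun r hr θ hθ => ?_
  have hcount (N : ℕ) : #{n ∈ range N | n % m = r} ≤ N / m + 1 := by
    have hcard := Nat.count_modEq_card N (r.zero_le.trans_lt hr) r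
    rw [Nat.count_eq_card_filter_range] at hcard
    simp only [Nat.ModEq, Nat.mod_eq_of_lt hr] at hcard
    rw [hcard]
    gcongr
    split_ifs <;> simp
  have hlim : Tendsto (fun N : ℕ => 1 / (m : ℝ) + (N : ℝ)⁻¹) atTop (𝓝 (1 / m)) := by
    simpa using (tendsto_inv_atTop_nhds_zero_nat (𝕜 := ℝ)).const_add (1 / (m : ℝ))
  filter_upwards [hlim.eventually_lt_const hθ, eventually_ne_atTop 0] with N hN hN0
  refine lt_of_le_of_lt ?_ hN
  calc cesaroMean N ({n | id n % m = r}.indicator 1)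
      = (N : ℝ)⁻¹ * #{n ∈ range N | n % m = r} := by
        simp [cesaroMean_apply, Set.indicator_apply]
    _ ≤ (N : ℝ)⁻¹ * (N / m + 1) := by
        gcongr
        exact (Nat.cast_le.2 (hcount N)).trans (by push_cast; gcongr; exact Nat.cast_div_le)
    _ = 1 / m + (N : ℝ)⁻¹ := by field_simp

theorem coe_mem_closedBall_of_floor_mod_eq {y : ℝ} (hy : 0 ≤ y) {m r : ℕ} (h : ⌊y⌋₊ % m = r) :
    (y : AddCircle (m : ℝ)) ∈ Metric.closedBall ((r + 1 / 2 : ℝ) : AddCircle (m : ℝ)) (1 / 2) := by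
  have hfloor : (⌊y⌋₊ : ℝ) = m * (⌊y⌋₊ / m : ℕ) + r := by
    rw [← h]
    exact_mod_cast (Nat.div_add_mod _ _).symm
  have hcoe : (y : AddCircle (m : ℝ)) = (y - (⌊y⌋₊ / m : ℕ) * m : ℝ) := by
    rw [AddCircle.coe_sub, ← nsmul_eq_mul, AddCircle.coe_nsmul, AddCircle.coe_period, smul_zero,
      sub_zero]
  rw [hcoe, Metric.mem_closedBall, dist_eq_norm, ← AddCircle.coe_sub]
  refine QuotientAddGroup.norm_mk_le_norm.trans (abs_le.2 ⟨?_, ?_⟩) <;>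
    linarith [Nat.floor_le hy, Nat.lt_floor_add_one y]

theorem measureReal_haarAddCircle_closedBall_le {T : ℝ} [hT : Fact (0 < T)] (z : AddCircle T)
    {ρ : ℝ} (hρ : 0 ≤ ρ) :
    (AddCircle.haarAddCircle (T := T)).real (Metric.closedBall z ρ) ≤ 2 * ρ / T := by
  have hvol := congrArg ENNReal.toReal (AddCircle.volume_closedBall T (x := z) ρ)
  rw [AddCircle.volume_eq_smul_haarAddCircle, Measure.smul_apply, smul_eq_mul, ENNReal.toReal_mul,
    ENNReal.toReal_ofReal hT.out.le, ENNReal.toReal_ofReal (le_min hT.out.le (by positivity))]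
    at hvol
  rw [le_div_iff₀' hT.out]
  exact hvol.trans_le (min_le_right _ _)

theorem equidistributedMod_floor {m : ℕ} [Fact (0 < (m : ℝ))] {y : ℕ → ℝ} (hy : 0 ≤ y)
    (h : IsEquidistributed AddCircle.haarAddCircle fun n => (y n : AddCircle (m : ℝ))) :
    EquidistributedMod m fun n => ⌊y n⌋₊ := by
  refine equidistributedMod_of_eventually_lt fun r _ θ hθ => ?_
  set K := Metric.closedBall ((r + 1 / 2 : ℝ) : AddCircle (m : ℝ)) (1 / 2)
  have hK : AddCircle.haarAddCircle.real K < θ :=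
    (measureReal_haarAddCircle_closedBall_le _ one_half_pos.le).trans_lt (by simpa using hθ)
  filter_upwards [h.eventually_cesaroMean_indicator_lt Metric.isClosed_closedBall hK] with N hN
  refine (cesaroMean_mono (Set.indicator_le_indicator_of_subset (fun n hn => ?_)
    fun _ => zero_le_one) N).trans_lt hN
  exact coe_mem_closedBall_of_floor_mod_eq (hy n) hn

theorem equidistributedMod_floor_rpow {c : ℝ} (hc : 0 < c) (hcz : ∀ m : ℤ, c ≠ m) {m : ℕ}
    (hm : 0 < m) : EquidistributedMod m fun n => ⌊(n : ℝ) ^ c⌋₊ :=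
  haveI : Fact (0 < (m : ℝ)) := ⟨Nat.cast_pos.2 hm⟩
  equidistributedMod_floor (fun n => Real.rpow_nonneg n.cast_nonneg c)
    (isEquidistributed_mul_rpow_addCircle hc hcz)

theorem tendsto_floor_rpow_atTop {c : ℝ} (hc : 0 < c) :
    Tendsto (fun n : ℕ => ⌊(n : ℝ) ^ c⌋₊) atTop atTop :=
  tendsto_nat_floor_atTop.comp ((tendsto_rpow_atTop hc).comp tendsto_natCast_atTop_atTop)

end Residues

section LowDigits

variable {k : ℕ} (hk : 1 < k)

/-- The last `L` base-`k` digits of `n`, most significant digit first, padded with leading zeros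
when `n < k ^ L`. -/
def lowDigits : ℕ → ℕ → List (Fin k)
  | 0, _ => []
  | L + 1, n => lowDigits L (n / k) ++ [⟨n % k, Nat.mod_lt n (by omega)⟩]

theorem lowDigits_mod_pow (L n : ℕ) : lowDigits hk L (n % k ^ L) = lowDigits hk L n := by
  induction L generalizing n with
  | zero => rfl
  | succ L ih =>
    have hdiv : n % k ^ (L + 1) / k = n / k % k ^ L := by
      rw [pow_succ', Nat.mod_mul_right_div_self]
    have hmod : n % k ^ (L + 1) % k = n % k := Nat.mod_mod_of_dvd _ (dvd_pow_self k L.succ_ne_zero)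
    simp only [lowDigits, hdiv, hmod, ih]

theorem lowDigits_add (L j n : ℕ) :
    lowDigits hk (L + j) n = lowDigits hk L (n / k ^ j) ++ lowDigits hk j n := by
  induction j generalizing n with
  | zero => simp [lowDigits]
  | succ j ih =>
    rw [← add_assoc, lowDigits, lowDigits, ih, Nat.div_div_eq_div_mul, ← pow_succ',
      List.append_assoc]

theorem exists_lowDigits_eq (w : List (Fin k)) :
    ∃ r < k ^ w.length, lowDigits hk w.length r = w := by
  induction w using List.reverseRecOn with
  | nil => exact ⟨0, by simp, rfl⟩
  | append_singleton w d ih =>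
    obtain ⟨r, hr, hrw⟩ := ih
    have hk0 : 0 < k := by omega
    have hdiv : (k * r + d) / k = r := by
      rw [Nat.mul_add_div hk0, Nat.div_eq_of_lt d.2, add_zero]
    have hmod : (k * r + d) % k = d := by
      rw [Nat.mul_add_mod, Nat.mod_eq_of_lt d.2]
    refine ⟨k * r + d, ?_, ?_⟩
    · rw [List.length_append, List.length_singleton, pow_succ']
      calc k * r + d < k * (r + 1) := by rw [mul_add_one]; gcongr; exact d.2
        _ ≤ k * k ^ w.length := Nat.mul_le_mul_left _ hr
    · simp only [List.length_append, List.length_singleton, lowDigits, hdiv, hmod, hrw, Fin.eta]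

theorem digitExpansion_of_ne_zero {n : ℕ} (hn : n ≠ 0) :
    digitExpansion k hk n =
      digitExpansion k hk (n / k) ++ [⟨n % k, Nat.mod_lt n (by omega)⟩] := by
  simp only [digitExpansion, Nat.digits_eq_cons_digits_div hk hn, List.pmap_cons,
    List.reverse_cons]

theorem digitExpansion_eq_append_lowDigits {L n : ℕ} (hn : k ^ L ≤ n) :
    digitExpansion k hk n = digitExpansion k hk (n / k ^ L) ++ lowDigits hk L n := by
  induction L generalizing n with
  | zero => simp [lowDigits]
  | succ L ih =>
    have hn0 : n ≠ 0 := ((pow_pos (by omega) _).trans_le hn).ne'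
    have hle : k ^ L ≤ n / k := by
      rwa [Nat.le_div_iff_mul_le (by omega), ← pow_succ]
    rw [digitExpansion_of_ne_zero hk hn0, ih hle, lowDigits, Nat.div_div_eq_div_mul, ← pow_succ',
      List.append_assoc]

end LowDigits

namespace DFAO

variable {k : ℕ} {σ A : Type*} {M : DFAO k σ A} {hk : 1 < k} {v w : List (Fin k)}

theorem run_append (q : σ) : M.run q (v ++ w) = M.run (M.run q v) w :=
  List.foldl_append

theorem IsSynchronizingWord.append_left (hw : M.IsSynchronizingWord w) (v : List (Fin k)) :
    M.IsSynchronizingWord (v ++ w) :=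
  hw.imp fun s hs q => by rw [run_append, hs]

theorem IsSynchronizingWord.append_right (hv : M.IsSynchronizingWord v) (w : List (Fin k)) :
    M.IsSynchronizingWord (v ++ w) :=
  hv.elim fun s hs => ⟨M.run s w, fun q => by rw [run_append, hs]⟩

theorem IsSynchronizingWord.run_eq_run (hw : M.IsSynchronizingWord w) (q q' : σ) :
    M.run q w = M.run q' w := by
  obtain ⟨s, hs⟩ := hw
  rw [hs, hs]

theorem Generates.eq_output_run_lowDigits {a : ℕ → A} (ha : M.Generates hk a) {L n : ℕ}
    (hn : k ^ L ≤ n) (hsync : M.IsSynchronizingWord (lowDigits hk L n)) (q : σ) :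
    a n = M.output (M.run q (lowDigits hk L n)) := by
  rw [← ha n, digitExpansion_eq_append_lowDigits hk hn, run_append, hsync.run_eq_run _ q]

variable (M hk)

open Classical in
/-- The residues modulo `k ^ L` whose `L` digits do not form a synchronizing word: those from
which the state of the automaton cannot be read off. -/
noncomputable def nonresetting (L : ℕ) : Finset ℕ :=
  {r ∈ range (k ^ L) | ¬ M.IsSynchronizingWord (lowDigits hk L r)}

variable {M hk}

theorem mem_nonresetting {L r : ℕ} : r ∈ M.nonresetting hk L ↔
    r < k ^ L ∧ ¬ M.IsSynchronizingWord (lowDigits hk L r) := by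
  simp [nonresetting]

theorem nonresetting_subset_range (L : ℕ) : M.nonresetting hk L ⊆ range (k ^ L) :=
  fun _ hr => mem_range.2 (mem_nonresetting.1 hr).1

theorem isSynchronizingWord_lowDigits_of_mod_notMem {L n : ℕ}
    (hn : n % k ^ L ∉ M.nonresetting hk L) : M.IsSynchronizingWord (lowDigits hk L n) := by
  rw [mem_nonresetting, lowDigits_mod_pow] at hn
  exact by_contra fun h => hn ⟨Nat.mod_lt _ (pow_pos (by omega) _), h⟩

/-- A word that does not reset the automaton neither ends in `w` nor has a resetting prefix. -/
theorem card_nonresetting_add_le (hw : M.IsSynchronizingWord w) (L : ℕ) :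
    #(M.nonresetting hk (L + w.length)) ≤ #(M.nonresetting hk L) * (k ^ w.length - 1) := by
  obtain ⟨v, hv, hvw⟩ := exists_lowDigits_eq hk w
  have hpos : 0 < k ^ w.length := pow_pos (by omega) _
  rw [← card_range (k ^ w.length), ← card_erase_of_mem (mem_range.2 hv), ← card_product]
  refine card_le_card_of_injOn (fun r => (r / k ^ w.length, r % k ^ w.length)) ?_ ?_
  · intro r hr
    obtain ⟨hlt, hr⟩ := mem_nonresetting.1 hr
    rw [lowDigits_add] at hr
    refine mem_coe.2 (mem_product.2 ⟨mem_nonresetting.2 ⟨?_, fun h => hr (h.append_right _)⟩,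
      mem_erase.2 ⟨fun h : r % k ^ w.length = v => hr (.append_left ?_ _),
        mem_range.2 (Nat.mod_lt _ hpos)⟩⟩)
    · rwa [Nat.div_lt_iff_lt_mul hpos, ← pow_add]
    · rwa [← lowDigits_mod_pow, h, hvw]
  · intro r _ r' _ h
    simp only [Prod.mk.injEq] at h
    rw [← Nat.div_add_mod r (k ^ w.length), ← Nat.div_add_mod r' (k ^ w.length), h.1, h.2]

theorem card_nonresetting_mul_le (hw : M.IsSynchronizingWord w) (j : ℕ) :
    #(M.nonresetting hk (j * w.length)) ≤ (k ^ w.length - 1) ^ j := by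
  induction j with
  | zero => simpa using card_le_card (nonresetting_subset_range (M := M) (hk := hk) 0)
  | succ j ih =>
    rw [add_mul, one_mul, pow_succ]
    exact (card_nonresetting_add_le hw _).trans (Nat.mul_le_mul_right _ ih)

theorem exists_card_nonresetting_div_lt (hw : M.IsSynchronizingWord w) {ε : ℝ} (hε : 0 < ε) :
    ∃ L : ℕ, (#(M.nonresetting hk L) : ℝ) / (k ^ L : ℕ) < ε := by
  have hpos : 0 < k ^ w.length := pow_pos (by omega) _
  have hratio : ((k ^ w.length - 1 : ℕ) : ℝ) / (k ^ w.length : ℕ) < 1 := by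
    rw [div_lt_one (Nat.cast_pos.2 hpos)]
    exact Nat.cast_lt.2 (Nat.sub_lt hpos one_pos)
  obtain ⟨j, hj⟩ := exists_pow_lt_of_lt_one hε hratio
  refine ⟨j * w.length, lt_of_le_of_lt ?_ hj⟩
  rw [div_pow, mul_comm j, pow_mul, Nat.cast_pow (k ^ w.length) j, mul_comm]
  gcongr
  exact_mod_cast card_nonresetting_mul_le hw j

theorem Generates.exists_forall_eventually_dist_lt {a : ℕ → A} (ha : M.Generates hk a)
    (hw : M.IsSynchronizingWord w) (α : A) {ε : ℝ} (hε : 0 < ε) :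
    ∃ θ : ℝ, ∀ b : ℕ → ℕ, Tendsto b atTop atTop → (∀ L, EquidistributedMod (k ^ L) b) →
      ∀ᶠ N in atTop, dist (cesaroMean N ({n | a (b n) = α}.indicator 1)) θ < ε := by
  classical
  obtain ⟨L, hL⟩ := exists_card_nonresetting_div_lt (hk := hk) hw hε
  obtain ⟨G, hGrange, hG⟩ : ∃ G ⊆ range (k ^ L), ∀ r < k ^ L,
      (r ∈ G ↔ M.output (M.run M.start (lowDigits hk L r)) = α) :=
    ⟨{r ∈ range (k ^ L) | M.output (M.run M.start (lowDigits hk L r)) = α}, filter_subset _ _,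
      fun r hr => by simp [hr]⟩
  refine ⟨#G / (k ^ L : ℕ), fun b hb hequi => ?_⟩
  refine ((hequi L).hasCesaroMean_indicator hGrange).eventually_dist_cesaroMean_lt
    ((hequi L).hasCesaroMean_indicator (nonresetting_subset_range L)) hL ?_
  filter_upwards [hb.eventually_ge_atTop (k ^ L)] with n hn
  simp only [Set.indicator_apply, Set.mem_ofPred_eq, Pi.one_apply]
  by_cases hmem : b n % k ^ L ∈ M.nonresetting hk L
  · rw [if_pos hmem]
    split_ifs <;> norm_num
  · have hGn : b n % k ^ L ∈ G ↔ a (b n) = α := by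
      rw [hG _ (Nat.mod_lt _ (pow_pos (by omega) _)), lowDigits_mod_pow,
        ha.eq_output_run_lowDigits hn (isSynchronizingWord_lowDigits_of_mod_notMem hmem) M.start]
    simp [hmem, hGn]

end DFAO

theorem exists_forall_tendsto_of_forall_eventually_dist_lt {ι β X : Type*} [Nonempty ι]
    [PseudoMetricSpace X] [CompleteSpace X] {l : Filter β} [l.NeBot] {F : ι → β → X}
    (h : ∀ ε > 0, ∃ x, ∀ i, ∀ᶠ N in l, dist (F i N) x < ε) :
    ∃ x, ∀ i, Tendsto (F i) l (𝓝 x) := by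
  have hcauchy : Cauchy (⨆ i, map (F i) l) := by
    refine Metric.cauchy_iff.2 ⟨iSup_neBot.2 ⟨Classical.arbitrary ι, inferInstance⟩, fun ε hε => ?_⟩
    obtain ⟨x, hx⟩ := h (ε / 2) (half_pos hε)
    refine ⟨Metric.ball x (ε / 2), mem_iSup.2 hx, fun y hy z hz => ?_⟩
    linarith [dist_triangle_right y z x, Metric.mem_ball.1 hy, Metric.mem_ball.1 hz]
  obtain ⟨x, hx⟩ := CompleteSpace.complete hcauchy
  exact ⟨x, fun i => iSup_le_iff.1 hx i⟩

theorem DFAO.Generates.exists_forall_hasFrequency {k : ℕ} {σ A : Type*} {M : DFAO k σ A}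
    {hk : 1 < k} {a : ℕ → A} (ha : M.Generates hk a) {w : List (Fin k)}
    (hw : M.IsSynchronizingWord w) (α : A) :
    ∃ θ, ∀ b : ℕ → ℕ, Tendsto b atTop atTop → (∀ L, EquidistributedMod (k ^ L) b) →
      HasFrequency (fun n => a (b n)) α θ := by
  let ι := {b : ℕ → ℕ // Tendsto b atTop atTop ∧ ∀ L, EquidistributedMod (k ^ L) b}
  have : Nonempty ι := ⟨⟨id, tendsto_id, fun L => equidistributedMod_id _⟩⟩
  obtain ⟨θ, hθ⟩ := exists_forall_tendsto_of_forall_eventually_dist_lt (l := atTop)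
    (F := fun (b : ι) N => cesaroMean N ({n | a (b.1 n) = α}.indicator (1 : ℕ → ℝ)))
    fun ε hε => (ha.exists_forall_eventually_dist_lt hw α hε).imp
      fun _ h b => h b.1 b.2.1 b.2.2
  exact ⟨θ, fun b hb hequi => (hasFrequency_iff_hasCesaroMean _ _ _).2 (hθ ⟨b, hb, hequi⟩)⟩

theorem theorem1_general {k : ℕ} (hk : 1 < k) {σ A : Type*} (M : DFAO k σ A) {a : ℕ → A}
    (ha : M.Generates hk a) {w : List (Fin k)} (hw : M.IsSynchronizingWord w) {c : ℝ} (hc : 0 < c)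
    (hcz : ∀ m : ℤ, c ≠ m) (α : A) :
    ∃ θ : ℝ, HasFrequency a α θ ∧ HasFrequency (fun n : ℕ => a ⌊(n : ℝ) ^ c⌋₊) α θ := by
  obtain ⟨θ, hθ⟩ := ha.exists_forall_hasFrequency hw α
  exact ⟨θ, hθ id tendsto_id fun L => equidistributedMod_id _,
    hθ _ (tendsto_floor_rpow_atTop hc) fun L => equidistributedMod_floor_rpow hc hcz
      (pow_pos (one_pos.trans hk) L)⟩

theorem theorem1 {A : Type*} (a : ℕ → A) (ha : IsSynchronizingAutomatic a)
    (c : ℝ) (hc : 1 < c) (hcz : ∀ m : ℤ, c ≠ (m : ℝ)) (α : A) :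
    ∃ θ : ℝ, HasFrequency a α θ ∧
      HasFrequency (fun n : ℕ => a ⌊(n : ℝ) ^ c⌋₊) α θ := by
  obtain ⟨k, hk, σ, -, M, hM, w, hw⟩ := ha
  exact theorem1_general hk M hM hw (one_pos.trans hc) hcz α
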